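/- **Conventions.** Manifolds are smooth, Hausdorff, second countable and without boundary. A (natural) polydifferential operator $D$ of rank $\ell+1$ ($\ell\ge 0$) on $n$-manifolds assigns to each Riemannian $n$-manifold $(M,g)$ a linear operator $D^g\colon C^\infty(M)^{\otimes\ell}\to C^\infty(M)$ such that $D^g(u_1\otimes\dotsm\otimes u_\ell)$ is an $\mathbb{R}$-linear combination, with coefficients independent of $(M,g)$, of complete contractions of tensors $\nabla^{N_1}\mathrm{Rm}\otimes\dotsm\otimes\nabla^{N_\kappa}\mathrm{Rm}\otimes\nabla^{N_{\kappa+1}}u_1\otimes\dotsm\otimes\nabla^{N_{\kappa+\ell}}u_\ell$. Its rank is denoted $r(D):=\ell+1$. - $D$ is *symmetric* if $D^g(u_{\sigma(1)}\otimes\dotsm\otimes u_{\sigma(\ell)})=D^g(u_1\otimes\dotsm\otimes u_\ell)$ for all $(M,g)$, all $u_j\in C^\infty(M)$ and all permutations $\sigma$. - $D$ is *formally self-adjoint* if $\int_M u_0\,D^g(u_1\otimes\dotsm\otimes u_\ell)\,\mathrm{dvol}_g$ is invariant under all permutations of $u_0,\dotsc,u_\ell\in C_0^\infty(M)$, for all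 $(M,g)$. - $D$ is *conformally covariant* if there are $a_1,\dotsc,a_\ell,b\in\mathbb{R}$ such that $D^{e^{2\Upsilon}g}(u_1\otimes\dotsm\otimes u_\ell)=e^{b\Upsilon}D^g(e^{-a_1\Upsilon}u_1\otimes\dotsm\otimes e^{-a_\ell\Upsilon}u_\ell)$ for all $(M,g)$ and all $\Upsilon,u_j\in C^\infty(M)$. - $D$ has *homogeneity* $h$ if $D^{c^2g}=c^hD^g$ for all $(M,g)$ and all constants $c>0$. Let $k\ge 0$ be an integer. A *constrained polydifferential operator* of rank $r$ and homogeneity $-2k$ on $n$-manifolds is a pair $(D,\mathscr{C})$ of a formally self-adjoint, conformally covariant polydifferential operator $D$ of rank $r$ and homogeneity $-2k$ on $n$-manifolds and a (possibly empty) finite set $\mathscr{C}$ of symmetric conformally covariant polydifferential operators on $n$-manifolds such that for each $C\in\mathscr{C}$ there is $b(C)\in\mathbb{R}$ with $$C^{e^{2\Upsilon}g}\bigl(u^{\otimes(r(C)-1)}\bigr)=e^{b(C)\Upsilon}\,C^g\Bigl(\bigl(e^{\frac{n-2k}{r}\Upsilon}u\bigr)^{\otimes(r(C)-1)}\Bigr)$$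 for all Riemannian $n$-manifolds $(M,g)$ and all $\Upsilon,u\in C^\infty(M)$. **Lemma.** Let $(D,\mathscr{C})$ be a constrained polydifferential operator of rank $r$ and homogeneity $-2k$ on $n$-manifolds. Given a Riemannian $n$-manifold $(M,g)$, set $$U_{\mathscr{C}}^g:=\bigl\{u\in C^\infty(M) : C^g\bigl(u^{\otimes(r(C)-1)}\bigr)>0 \text{ everywhere on } M, \text{ for all } C\in\mathscr{C}\bigr\}.$$ Then, for all Riemannian $n$-manifolds $(M,g)$: 1. If $u\in U_{\mathscr{C}}^g$ and $c>0$ is a constant, then $cu\in U_{\mathscr{C}}^g$. 2. If $\Upsilon\in C^\infty(M)$ and $\widehat g=e^{2\Upsilon}g$, then $U_{\mathscr{C}}^{\widehat g}=e^{-\frac{n-2k}{r}\Upsilon}\,U_{\mathscr{C}}^g$. 3. If $\widehat M$ is an $n$-manifold and $f\colon\widehat M\to M$ is a (smooth) local diffeomorphism, then $f^*(U_{\mathscr{C}}^g)\subseteq U_{\mathscr{C}}^{f^*g}$. -/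

import Mathlib

open scoped Manifold ContDiff TensorProduct Topology

universe u

noncomputable section

namespace ConfCone

/-! ### Riemannian metrics on smooth `n`-manifolds

A smooth `n`-manifold is a Hausdorff, σ-compact (equivalently, second countable) space with a
smooth atlas modelled on `ℝⁿ`; it has no boundary and need not be connected. -/

/-- The model space `ℝⁿ`. -/
abbrev Model (n : ℕ) : Type := EuclideanSpace ℝ (Fin n)

/-- The space `C^∞(M)` of smooth real-valued functions. -/
abbrev SmoothFn (n : ℕ) (M : Type u) [TopologicalSpace M] [ChartedSpace (Model n) M] : Type u :=
  C^∞⟮𝓡 n, M; ℝ⟯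

/-- Smooth Riemannian metrics on `M`. -/
abbrev Metric (n : ℕ) (M : Type u) [TopologicalSpace M] [ChartedSpace (Model n) M]
    [IsManifold (𝓡 n) ∞ M] : Type u :=
  Bundle.ContMDiffRiemannianMetric (𝓡 n) ∞ (Model n) (fun x : M => TangentSpace (𝓡 n) x)

section Metrics

variable {n : ℕ} {M : Type u} [TopologicalSpace M] [ChartedSpace (Model n) M]
  [IsManifold (𝓡 n) ∞ M]

/-- The smooth function `e^{wΥ}`. -/
def expFn (w : ℝ) (Υ : SmoothFn n M) : SmoothFn n M :=
  ⟨fun x => Real.exp (w * Υ x),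
    Real.contDiff_exp.contMDiff.comp (contMDiff_const.mul Υ.contMDiff)⟩

/-- The metric `ρ g`, for a positive smooth function `ρ`. -/
def Metric.rescale (ρ : SmoothFn n M) (hρ : ∀ x, 0 < ρ x) (g : Metric n M) : Metric n M where
  inner x := ρ x • g.inner x
  symm x v w := by
    change ρ x * g.inner x v w = ρ x * g.inner x w v
    rw [g.symm]
  pos x v hv := mul_pos (hρ x) (g.pos x v hv)
  isVonNBounded x := by
    have h := (g.isVonNBounded x).image
      ((Real.sqrt (ρ x))⁻¹ • ContinuousLinearMap.id ℝ (TangentSpace (𝓡 n) x))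
    refine h.subset ?_
    intro v hv
    have hs : 0 < Real.sqrt (ρ x) := Real.sqrt_pos.2 (hρ x)
    refine ⟨Real.sqrt (ρ x) • v, ?_, ?_⟩
    · have hv' : ρ x * g.inner x v v < 1 := hv
      change g.inner x (Real.sqrt (ρ x) • v) (Real.sqrt (ρ x) • v) < 1
      simp only [map_smul, smul_apply, smul_eq_mul]
      rwa [← mul_assoc, Real.mul_self_sqrt (hρ x).le]
    · change (Real.sqrt (ρ x))⁻¹ • (Real.sqrt (ρ x) • v) = v
      rw [smul_smul, inv_mul_cancel₀ hs.ne', one_smul]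
  contMDiff := ContMDiff.smul_section ρ.contMDiff g.contMDiff

/-- The conformally related metric `e^{2Υ} g`. -/
def Metric.conformal (Υ : SmoothFn n M) (g : Metric n M) : Metric n M :=
  g.rescale (expFn 2 Υ) (fun _ => Real.exp_pos _)

/-- The homothetic metric `c² g`, for a constant `c > 0`. -/
def Metric.homothetic (c : ℝ) (hc : 0 < c) (g : Metric n M) : Metric n M :=
  g.rescale ⟨fun _ => c ^ 2, contMDiff_const⟩ (fun _ => pow_pos hc 2)

variable {N : Type u} [TopologicalSpace N] [ChartedSpace (Model n) N] [IsManifold (𝓡 n) ∞ N]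

/-- The pullback `f^* u = u ∘ f` of a smooth function. -/
def pullbackFn (f : N → M) (hf : IsLocalDiffeomorph (𝓡 n) (𝓡 n) ∞ f) (v : SmoothFn n M) :
    SmoothFn n N :=
  ⟨fun x => v (f x), v.contMDiff.comp hf.contMDiff⟩

/-- A bilinear form on a tangent space, read in the trivialization of the bundle of bilinear
forms around `x₀`. -/
theorem inCoordinates_bilin (x₀ x : M)
    (hx : x ∈ (trivializationAt (Model n) (TangentSpace (𝓡 n) : M → Type) x₀).baseSet)
    (B : TangentSpace (𝓡 n) x →L[ℝ] TangentSpace (𝓡 n) x →L[ℝ] ℝ) (v w : Model n) :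
    ContinuousLinearMap.inCoordinates (Model n) (TangentSpace (𝓡 n) : M → Type)
      (Model n →L[ℝ] ℝ) (fun x : M => TangentSpace (𝓡 n) x →L[ℝ] Bundle.Trivial M ℝ x)
      x₀ x x₀ x B v w =
    B ((trivializationAt (Model n) (TangentSpace (𝓡 n) : M → Type) x₀).symmL ℝ x v)
      ((trivializationAt (Model n) (TangentSpace (𝓡 n) : M → Type) x₀).symmL ℝ x w) := by
  rw [ContinuousLinearMap.inCoordinates_eq hx (by simpa using hx)]
  simp [hom_trivializationAt_apply, ContinuousLinearMap.inCoordinates]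
  rw [Bundle.Trivialization.symmL_apply _ hx v]

/-- The pullback metric `f^* g`, for a local diffeomorphism `f`:
`(f^* g)_x(v, w) = g_{f x}(df_x v, df_x w)`. -/
def Metric.pullback (f : N → M) (hf : IsLocalDiffeomorph (𝓡 n) (𝓡 n) ∞ f) (g : Metric n M) :
    Metric n N where
  inner x := (ContinuousLinearMap.precomp ℝ (mfderiv (𝓡 n) (𝓡 n) f x)).comp
    ((g.inner (f x)).comp (mfderiv (𝓡 n) (𝓡 n) f x))
  symm x v w := g.symm _ _ _
  pos x v hv := by
    refine g.pos _ _ ?_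
    intro h0
    apply hv
    have := (hf.mfderivToContinuousLinearEquiv (by simp) x).injective (a₁ := v) (a₂ := 0)
    apply this
    rw [map_zero]
    exact h0
  isVonNBounded x := by
    let e := hf.mfderivToContinuousLinearEquiv (by simp) x
    have h := (g.isVonNBounded (f x)).image
      (e.symm : TangentSpace (𝓡 n) (f x) →L[ℝ] TangentSpace (𝓡 n) x)
    refine h.subset ?_
    intro v hv
    exact ⟨e v, hv, e.symm_apply_apply v⟩
  contMDiff := by
    intro x₀
    have hA := (hf.contMDiff x₀).mfderiv_const (m := ∞) (by simp)
    have hG := ((Bundle.contMDiffAt_section _).1 (g.contMDiff (f x₀))).comp x₀ (hf.contMDiff x₀)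
    rw [Bundle.contMDiffAt_section]
    refine ((hA.clm_precomp (F₃ := ℝ)).clm_comp (hG.clm_comp hA)).congr_of_eventuallyEq ?_
    have h1 := (trivializationAt (Model n) (TangentSpace (𝓡 n) : N → Type) x₀).open_baseSet.mem_nhds
      (FiberBundle.mem_baseSet_trivializationAt' x₀)
    have h2 := hf.contMDiff.continuous.continuousAt.preimage_mem_nhds
      ((trivializationAt (Model n) (TangentSpace (𝓡 n) : M → Type) (f x₀)).open_baseSet.mem_nhds
      (FiberBundle.mem_baseSet_trivializationAt' (f x₀)))
    filter_upwards [h1, h2] with x hx hx'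
    have hx'' : f x ∈ (trivializationAt (Model n) (TangentSpace (𝓡 n) : M → Type) (f x₀)).baseSet :=
      hx'
    ext v w
    rw [hom_trivializationAt_apply]
    refine (inCoordinates_bilin x₀ x hx _ v w).trans ?_
    simp only [Function.comp_apply, hom_trivializationAt_apply]
    have key := inCoordinates_bilin (f x₀) (f x) hx' (g.inner (f x))
      (inTangentCoordinates (𝓡 n) (𝓡 n) id f (mfderiv (𝓡 n) (𝓡 n) f) x₀ x v)
      (inTangentCoordinates (𝓡 n) (𝓡 n) id f (mfderiv (𝓡 n) (𝓡 n) f) x₀ x w)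
    refine Eq.trans ?_ key.symm
    have hc : ∀ v : Model n,
        (trivializationAt (Model n) (TangentSpace (𝓡 n) : M → Type) (f x₀)).symmL ℝ (f x)
          (inTangentCoordinates (𝓡 n) (𝓡 n) id f (mfderiv (𝓡 n) (𝓡 n) f) x₀ x v) =
        mfderiv (𝓡 n) (𝓡 n) f x
          ((trivializationAt (Model n) (TangentSpace (𝓡 n) : N → Type) x₀).symmL ℝ x v) := by
      intro v
      exact Bundle.Trivialization.symmL_continuousLinearMapAt _ hx'' _
    rw [hc, hc]
    rfl

end Metrics

/-! ### Tensor calculus in a coordinate chart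

The following objects live on the image of a chart in `ℝⁿ`. The matrix-valued function `G` stands
for the components `g_{ij}` of the metric in the chart, and a covariant tensor field of rank `m` is
given by its components `T_{i₁ … i_m}`. -/

section Coordinates

variable {n : ℕ}

/-- The coordinate vector `e_i` of `ℝⁿ`. -/
def basisVec (i : Fin n) : Model n := EuclideanSpace.single i (1 : ℝ)

/-- The partial derivative `∂_i F`. -/
def pd (i : Fin n) (F : Model n → ℝ) (y : Model n) : ℝ := fderiv ℝ F y (basisVec i)

/-- The Christoffel symbol `Γ^l_{ij} = ½ g^{lm} (∂_i g_{jm} + ∂_j g_{im} - ∂_m g_{ij})` of the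
Levi-Civita connection. -/
def christoffel (G : Model n → Matrix (Fin n) (Fin n) ℝ) (l i j : Fin n) (y : Model n) : ℝ :=
  (1 / 2 : ℝ) * ∑ m, (G y)⁻¹ l m *
    (pd i (fun z => G z j m) y + pd j (fun z => G z i m) y - pd m (fun z => G z i j) y)

/-- The components of a field of covariant tensors of rank `m`. -/
abbrev CoordTensor (n m : ℕ) : Type := Model n → (Fin m → Fin n) → ℝ

/-- The Riemann curvature tensor `R_{ijkl} = g_{lm} R_{ijk}^m`, where
`R_{ijk}^m = ∂_i Γ^m_{jk} - ∂_j Γ^m_{ik} + Γ^m_{ip} Γ^p_{jk} - Γ^m_{jp} Γ^p_{ik}`. -/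
def riemann (G : Model n → Matrix (Fin n) (Fin n) ℝ) : CoordTensor n 4 := fun y I =>
  ∑ m, G y (I 3) m *
    (pd (I 0) (christoffel G m (I 1) (I 2)) y - pd (I 1) (christoffel G m (I 0) (I 2)) y +
      ∑ p, (christoffel G m (I 0) p y * christoffel G p (I 1) (I 2) y -
        christoffel G m (I 1) p y * christoffel G p (I 0) (I 2) y))

/-- The covariant derivative
`(∇T)_{i j₁ … j_m} = ∂_i T_{j₁ … j_m} - ∑_a Γ^l_{i j_a} T_{j₁ … l … j_m}`. -/
def covDeriv (G : Model n → Matrix (Fin n) (Fin n) ℝ) {m : ℕ} (T : CoordTensor n m) :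
    CoordTensor n (m + 1) := fun y I =>
  pd (I 0) (fun z => T z (Fin.tail I)) y -
    ∑ a : Fin m, ∑ l, christoffel G l (I 0) (I a.succ) y * T y (Function.update (Fin.tail I) a l)

/-- The iterated covariant derivative `∇^N T`. -/
def iterCovDeriv (G : Model n → Matrix (Fin n) (Fin n) ℝ) {m : ℕ} (T : CoordTensor n m) :
    (N : ℕ) → CoordTensor n (m + N)
  | 0 => T
  | N + 1 => covDeriv G (iterCovDeriv G T N)

end Coordinates

/-- A complete contraction of the tensor
`∇^{N₁}Rm ⊗ ⋯ ⊗ ∇^{N_κ}Rm ⊗ ∇^{N'₁}u₁ ⊗ ⋯ ⊗ ∇^{N'_ℓ}u_ℓ`: the orders of differentiation, together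
with an arrangement of all the index slots of the tensor into pairs. -/
structure Contraction (ℓ : ℕ) where
  /-- The number `κ` of curvature factors. -/
  numCurv : ℕ
  /-- The orders `N₁, …, N_κ`. -/
  curvOrder : Fin numCurv → ℕ
  /-- The orders `N'₁, …, N'_ℓ`. -/
  fnOrder : Fin ℓ → ℕ
  /-- The number of pairs. -/
  numPairs : ℕ
  /-- The `q`-th pair consists of the images of `Sum.inl q` and `Sum.inr q`. -/
  pairing : Fin numPairs ⊕ Fin numPairs ≃
    (Σ a : Fin numCurv, Fin (4 + curvOrder a)) ⊕ (Σ j : Fin ℓ, Fin (0 + fnOrder j))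

/-- The value at the point `y` of the complete contraction, computed in coordinates in which the
metric has the components `G` and the functions `u₁, …, u_ℓ` are given by `v`; the paired indices are
contracted by means of the inverse metric `g^{ij}`. -/
def Contraction.eval {n ℓ : ℕ} (K : Contraction ℓ) (G : Model n → Matrix (Fin n) (Fin n) ℝ)
    (v : Fin ℓ → Model n → ℝ) (y : Model n) : ℝ :=
  ∑ I : (Σ a : Fin K.numCurv, Fin (4 + K.curvOrder a)) ⊕
      (Σ j : Fin ℓ, Fin (0 + K.fnOrder j)) → Fin n,
    (∏ q : Fin K.numPairs,
        (G y)⁻¹ (I (K.pairing (Sum.inl q))) (I (K.pairing (Sum.inr q)))) *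
      (∏ a : Fin K.numCurv,
        iterCovDeriv G (riemann G) (K.curvOrder a) y (fun s => I (Sum.inl ⟨a, s⟩))) *
      ∏ j : Fin ℓ,
        iterCovDeriv G (m := 0) (fun z _ => v j z) (K.fnOrder j) y (fun s => I (Sum.inr ⟨j, s⟩))

section Charts

variable {n : ℕ} {M : Type u} [TopologicalSpace M] [ChartedSpace (Model n) M]
  [IsManifold (𝓡 n) ∞ M]

/-- The coordinate vector field `∂_i` of the chart `φ`, at the point with coordinates `y`. -/
def coordVec (φ : OpenPartialHomeomorph M (Model n)) (y : Model n) (i : Fin n) :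
    TangentSpace (𝓡 n) (φ.symm y) :=
  mfderiv (𝓡 n) (𝓡 n) φ.symm y (basisVec i)

/-- The components `g_{ij} = g(∂_i, ∂_j)` of the metric in the chart `φ`. -/
def Metric.coord (g : Metric n M) (φ : OpenPartialHomeomorph M (Model n)) (y : Model n) :
    Matrix (Fin n) (Fin n) ℝ :=
  Matrix.of fun i j => g.inner (φ.symm y) (coordVec φ y i) (coordVec φ y j)

variable [T2Space M] [SigmaCompactSpace M]

variable (n M) in
/-- A smooth partition of unity subordinate to the preferred charts of `M`. -/
def chartPartition : SmoothPartitionOfUnity M (𝓡 n) M Set.univ :=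
  (SmoothPartitionOfUnity.exists_isSubordinate_chartAt_source (𝓡 n) M).choose

/-- The integral `∫_M F dvol_g` of a compactly supported function, computed by means of a partition
of unity and the formula `dvol_g = √det(g_{ij}) dy¹ ⋯ dyⁿ` in charts. -/
def Metric.integral (g : Metric n M) (F : M → ℝ) : ℝ :=
  ∑ᶠ p : M, ∫ y in (chartAt (Model n) p).target,
    chartPartition n M p ((chartAt (Model n) p).symm y) * F ((chartAt (Model n) p).symm y) *
      Real.sqrt (g.coord (chartAt (Model n) p) y).det

end Charts

/-! ### Polydifferential operators -/

/-- A natural polydifferential operator on `n`-manifolds: an assignment to each Riemannian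
`n`-manifold `(M, g)` of a linear operator `D^g : C^∞(M)^{⊗ℓ} → C^∞(M)` which is given by a universal
`ℝ`-linear combination of complete contractions. The contractions are computed in local coordinates
around the point at hand; as they are contractions of tensors, it does not matter which ones. -/
structure PolydiffOp (n : ℕ) where
  /-- The number `ℓ` of arguments. -/
  numArgs : ℕ
  /-- The operator `D^g`. -/
  op : ∀ {M : Type u} [TopologicalSpace M] [ChartedSpace (Model n) M] [IsManifold (𝓡 n) ∞ M]
    [T2Space M] [SigmaCompactSpace M], Metric n M →
      (⨂[ℝ] _ : Fin numArgs, SmoothFn n M) →ₗ[ℝ] SmoothFn n M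
  /-- The coefficients of the linear combination do not depend on `(M, g)`. -/
  natural : ∃ a : Contraction numArgs →₀ ℝ,
    ∀ {M : Type u} [TopologicalSpace M] [ChartedSpace (Model n) M] [IsManifold (𝓡 n) ∞ M]
      [T2Space M] [SigmaCompactSpace M] (g : Metric n M) (v : Fin numArgs → SmoothFn n M),
      ∀ φ ∈ IsManifold.maximalAtlas (𝓡 n) ∞ M, ∀ x ∈ φ.source,
        op g (⨂ₜ[ℝ] j, v j) x =
          a.sum fun K c => c * K.eval (g.coord φ) (fun j => v j ∘ φ.symm) (φ x)

namespace PolydiffOp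

variable {n : ℕ} (D : PolydiffOp.{u} n)

/-- An operator on `C^∞(M)^{⊗ℓ}` has rank `ℓ + 1`. -/
def rank : ℕ := D.numArgs + 1

/-- `D^{c²g} = c^h D^g` for all constants `c > 0`. -/
def HasHomogeneity (h : ℝ) : Prop :=
  ∀ {M : Type u} [TopologicalSpace M] [ChartedSpace (Model n) M] [IsManifold (𝓡 n) ∞ M]
    [T2Space M] [SigmaCompactSpace M] (g : Metric n M) (c : ℝ) (hc : 0 < c),
    D.op (g.homothetic c hc) = c ^ h • D.op g

/-- `D^g(u_{σ(1)} ⊗ ⋯ ⊗ u_{σ(ℓ)}) = D^g(u₁ ⊗ ⋯ ⊗ u_ℓ)`. -/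
def IsSymmetric : Prop :=
  ∀ {M : Type u} [TopologicalSpace M] [ChartedSpace (Model n) M] [IsManifold (𝓡 n) ∞ M]
    [T2Space M] [SigmaCompactSpace M] (g : Metric n M) (v : Fin D.numArgs → SmoothFn n M)
    (σ : Equiv.Perm (Fin D.numArgs)),
    D.op g (⨂ₜ[ℝ] j, v (σ j)) = D.op g (⨂ₜ[ℝ] j, v j)

/-- The Dirichlet form `𝔇^g(u₀ ⊗ u₁ ⊗ ⋯ ⊗ u_ℓ) = ∫_M u₀ D^g(u₁ ⊗ ⋯ ⊗ u_ℓ) dvol_g`. -/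
def dirichletForm {M : Type u} [TopologicalSpace M] [ChartedSpace (Model n) M]
    [IsManifold (𝓡 n) ∞ M] [T2Space M] [SigmaCompactSpace M] (g : Metric n M)
    (v : Fin (D.numArgs + 1) → SmoothFn n M) : ℝ :=
  g.integral fun x => v 0 x * D.op g (⨂ₜ[ℝ] j : Fin D.numArgs, v j.succ) x

/-- The Dirichlet form is symmetric on compactly supported smooth functions. -/
def IsFormallySelfAdjoint : Prop :=
  ∀ {M : Type u} [TopologicalSpace M] [ChartedSpace (Model n) M] [IsManifold (𝓡 n) ∞ M]
    [T2Space M] [SigmaCompactSpace M] (g : Metric n M)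
    (v : Fin (D.numArgs + 1) → SmoothFn n M) (_ : ∀ j, HasCompactSupport (v j))
    (σ : Equiv.Perm (Fin (D.numArgs + 1))),
    D.dirichletForm g (fun j => v (σ j)) = D.dirichletForm g v

/-- There are weights `a₁, …, a_ℓ, b` such that
`D^{e^{2Υ}g}(u₁ ⊗ ⋯ ⊗ u_ℓ) = e^{bΥ} D^g(e^{-a₁Υ}u₁ ⊗ ⋯ ⊗ e^{-a_ℓΥ}u_ℓ)`. -/
def IsConformallyCovariant : Prop :=
  ∃ (a : Fin D.numArgs → ℝ) (b : ℝ),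
    ∀ {M : Type u} [TopologicalSpace M] [ChartedSpace (Model n) M] [IsManifold (𝓡 n) ∞ M]
      [T2Space M] [SigmaCompactSpace M] (g : Metric n M) (Υ : SmoothFn n M)
      (v : Fin D.numArgs → SmoothFn n M),
      D.op (g.conformal Υ) (⨂ₜ[ℝ] j, v j) =
        expFn b Υ * D.op g (⨂ₜ[ℝ] j, expFn (-a j) Υ * v j)

end PolydiffOp

/-- A constrained polydifferential operator `(D, 𝒞)` of rank `r` and homogeneity `-2k` on
`n`-manifolds. -/
structure ConstrainedOp (n r k : ℕ) where
  /-- The operator `D`. -/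
  D : PolydiffOp.{u} n
  rank_eq : D.rank = r
  homogeneity : D.HasHomogeneity (-2 * (k : ℝ))
  selfAdjoint : D.IsFormallySelfAdjoint
  covariant : D.IsConformallyCovariant
  /-- The finite, possibly empty set `𝒞` of constraints. -/
  constraints : Finset (PolydiffOp.{u} n)
  symmetric_mem : ∀ C ∈ constraints, C.IsSymmetric
  covariant_mem : ∀ C ∈ constraints, C.IsConformallyCovariant
  /-- `C^{e^{2Υ}g}(u^{⊗(r(C)-1)}) = e^{bΥ} C^g((e^{((n-2k)/r)Υ} u)^{⊗(r(C)-1)})`. -/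
  transform_mem : ∀ C ∈ constraints, ∃ b : ℝ,
    ∀ {M : Type u} [TopologicalSpace M] [ChartedSpace (Model n) M] [IsManifold (𝓡 n) ∞ M]
      [T2Space M] [SigmaCompactSpace M] (g : Metric n M) (Υ v : SmoothFn n M),
      C.op (g.conformal Υ) (⨂ₜ[ℝ] _ : Fin C.numArgs, v) =
        expFn b Υ *
          C.op g (⨂ₜ[ℝ] _ : Fin C.numArgs, expFn (((n : ℝ) - 2 * (k : ℝ)) / (r : ℝ)) Υ * v)

/-- The constrained cone `U_𝒞^g`: the set of all `u ∈ C^∞(M)` such that `C^g(u^{⊗(r(C)-1)})` is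
positive everywhere on `M`, for all `C ∈ 𝒞`. -/
def ConstrainedOp.cone {n r k : ℕ} (P : ConstrainedOp.{u} n r k) {M : Type u}
    [TopologicalSpace M] [ChartedSpace (Model n) M] [IsManifold (𝓡 n) ∞ M] [T2Space M]
    [SigmaCompactSpace M] (g : Metric n M) : Set (SmoothFn n M) :=
  {v | ∀ C ∈ P.constraints, ∀ x : M, 0 < C.op g (⨂ₜ[ℝ] _ : Fin C.numArgs, v) x}

end ConfCone

end

/-! The three claims rest on multilinearity, conformal covariance and naturality. Scaling: a
constraint with `ℓ` arguments is homogeneous of degree `ℓ` on tensor powers, so a positive constant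
multiplies its value by a positive number (`op_smul_tprod`). Conformal change: the transformation
law leaves only a positive factor `e^{bΥ}`, which does not affect the sign, and multiplication by an
exponential is invertible (`mem_cone_conformal_iff`). Pullback: complete contractions are local, and
a local diffeomorphism is the identity in suitable charts. There the metrics `f^*g` and `g` have the
same components, so the universal formula takes the same value at `x` and at `f x`
(`PolydiffOp.op_pullback`). Positivity of a constraint on all of `M` thus gives positivity at every
point of the source; surjectivity of `f` plays no role. -/

namespace ConfCone

open Filter

/-! ### Complete contractions depend only on germs -/

section Locality

variable {n : ℕ} {y : Model n}

/-- Equality near `y`, not merely at `y`, is what survives differentiation; keeping it in the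
conclusion lets the argument be iterated to any order. -/
theorem pd_congr {F F' : Model n → ℝ} (h : F =ᶠ[𝓝 y] F') (i : Fin n) : pd i F =ᶠ[𝓝 y] pd i F' := by
  filter_upwards [h.fderiv (𝕜 := ℝ)] with z hz
  simp only [pd, hz]

variable {G G' : Model n → Matrix (Fin n) (Fin n) ℝ}

theorem christoffel_congr (h : G =ᶠ[𝓝 y] G') (l i j : Fin n) :
    christoffel G l i j =ᶠ[𝓝 y] christoffel G' l i j := by
  have hpd : ∀ a b c : Fin n,
      pd c (fun z => G z a b) =ᶠ[𝓝 y] pd c (fun z => G' z a b) := fun a b c =>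
    pd_congr (h.mono fun z hz => by simp only [hz]) c
  have hall : ∀ᶠ z in 𝓝 y, ∀ a b c : Fin n,
      pd c (fun z => G z a b) z = pd c (fun z => G' z a b) z := by
    -- There are finitely many indices, so the neighbourhoods for the separate components can be
    -- intersected.
    simp only [eventually_all]
    exact hpd
  filter_upwards [h, hall] with z hz hz'
  simp only [christoffel, hz, hz']

theorem riemann_congr (h : G =ᶠ[𝓝 y] G') : riemann G =ᶠ[𝓝 y] riemann G' := by
  have h1 : ∀ᶠ z in 𝓝 y, ∀ l i j, christoffel G l i j z = christoffel G' l i j z := by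
    simp only [eventually_all]
    exact fun l i j => christoffel_congr h l i j
  have h2 : ∀ᶠ z in 𝓝 y, ∀ c l i j,
      pd c (christoffel G l i j) z = pd c (christoffel G' l i j) z := by
    simp only [eventually_all]
    exact fun c l i j => pd_congr (christoffel_congr h l i j) c
  filter_upwards [h, h1, h2] with z hz hz1 hz2
  funext I
  simp only [riemann, hz, hz1, hz2]

theorem covDeriv_congr (h : G =ᶠ[𝓝 y] G') {m : ℕ} {T T' : CoordTensor n m} (hT : T =ᶠ[𝓝 y] T') :
    covDeriv G T =ᶠ[𝓝 y] covDeriv G' T' := by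
  have h1 : ∀ᶠ z in 𝓝 y, ∀ l i j, christoffel G l i j z = christoffel G' l i j z := by
    simp only [eventually_all]
    exact fun l i j => christoffel_congr h l i j
  have h2 : ∀ᶠ z in 𝓝 y, ∀ (c : Fin n) (J : Fin m → Fin n),
      pd c (fun w => T w J) z = pd c (fun w => T' w J) z := by
    simp only [eventually_all]
    exact fun c J =>
      pd_congr (hT.mono fun z hz => by simp only [hz]) c
  filter_upwards [hT, h1, h2] with z hz hz1 hz2
  funext I
  simp only [covDeriv, hz, hz1, hz2]

theorem iterCovDeriv_congr (h : G =ᶠ[𝓝 y] G') {m : ℕ} {T T' : CoordTensor n m}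
    (hT : T =ᶠ[𝓝 y] T') (N : ℕ) : iterCovDeriv G T N =ᶠ[𝓝 y] iterCovDeriv G' T' N := by
  induction N with
  | zero => exact hT
  | succ N ih => exact covDeriv_congr h ih

/-- The value of a complete contraction at a point depends only on the germs of the metric and of
the functions at that point. -/
theorem Contraction.eval_congr {ℓ : ℕ} (K : Contraction ℓ) (h : G =ᶠ[𝓝 y] G')
    {v v' : Fin ℓ → Model n → ℝ} (hv : ∀ j, v j =ᶠ[𝓝 y] v' j) :
    K.eval G v y = K.eval G' v' y := by
  have h1 : ∀ N, iterCovDeriv G (riemann G) N y = iterCovDeriv G' (riemann G') N y := fun N =>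
    (iterCovDeriv_congr h (riemann_congr h) N).eq_of_nhds
  have h2 : ∀ j N, iterCovDeriv G (m := 0) (fun z _ => v j z) N y =
      iterCovDeriv G' (m := 0) (fun z _ => v' j z) N y := fun j N =>
    (iterCovDeriv_congr h ((hv j).mono fun z hz => by simp only [hz]) N).eq_of_nhds
  simp only [Contraction.eval, h.eq_of_nhds, h1, h2]

end Locality

/-! ### Naturality under local diffeomorphisms -/

section Pullback

variable {n : ℕ} {M N : Type u} [TopologicalSpace M] [ChartedSpace (Model n) M]
  [IsManifold (𝓡 n) ∞ M] [TopologicalSpace N] [ChartedSpace (Model n) N] [IsManifold (𝓡 n) ∞ N]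

/-- A partial diffeomorphism followed by a chart is a chart. -/
theorem trans_mem_maximalAtlas (Φ : PartialDiffeomorph (𝓡 n) (𝓡 n) N M ∞)
    {φ : OpenPartialHomeomorph M (Model n)} (hφ : φ ∈ IsManifold.maximalAtlas (𝓡 n) ∞ M) :
    Φ.toOpenPartialHomeomorph.trans φ ∈ IsManifold.maximalAtlas (𝓡 n) ∞ N := by
  have h1 : ContMDiffOn (𝓡 n) (𝓡 n) ∞ φ φ.source := contMDiffOn_of_mem_maximalAtlas hφ
  have h2 : ContMDiffOn (𝓡 n) (𝓡 n) ∞ φ.symm φ.target := contMDiffOn_symm_of_mem_maximalAtlas hφ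
  exact OpenPartialHomeomorph.mem_maximalAtlas_of_contMDiffOn _
    (h1.comp' Φ.contMDiffOn_toFun) (Φ.contMDiffOn_invFun.comp' h2)

/-- Every tangent space unfolds to `Model n`, so vectors at propositionally equal base points can be
compared without a transport. -/
theorem Metric.inner_congr_point (g : Metric n M) {p q : M} (h : p = q) (a b : Model n) :
    (g.inner p : Model n →L[ℝ] Model n →L[ℝ] ℝ) a b =
      (g.inner q : Model n →L[ℝ] Model n →L[ℝ] ℝ) a b := by
  subst h
  rfl

/-- If a local diffeomorphism `f` reads as the identity in the charts `ψ` and `φ`, then the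
components of `f^* g` in `ψ` are those of `g` in `φ`. -/
theorem Metric.coord_pullback {f : N → M} (hf : IsLocalDiffeomorph (𝓡 n) (𝓡 n) ∞ f)
    (g : Metric n M) {ψ : OpenPartialHomeomorph N (Model n)}
    (hψ : ψ ∈ IsManifold.maximalAtlas (𝓡 n) ∞ N) {φ : OpenPartialHomeomorph M (Model n)}
    (h : Set.EqOn (f ∘ ψ.symm) φ.symm ψ.target) {y : Model n} (hy : y ∈ ψ.target) :
    (g.pullback f hf).coord ψ y = g.coord φ y := by
  have hd : MDifferentiableAt (𝓡 n) (𝓡 n) ψ.symm y :=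
    (contMDiffAt_symm_of_mem_maximalAtlas hψ hy).mdifferentiableAt (by simp)
  have hfd : MDifferentiableAt (𝓡 n) (𝓡 n) f (ψ.symm y) :=
    (hf.contMDiff _).mdifferentiableAt (by simp)
  -- By the chain rule, `df` then carries the coordinate vectors of `ψ` to those of `φ`.
  have hev : f ∘ ψ.symm =ᶠ[𝓝 y] φ.symm := h.eventuallyEq_of_mem (ψ.open_target.mem_nhds hy)
  have hc : ∀ i, (mfderiv (𝓡 n) (𝓡 n) f (ψ.symm y) (coordVec ψ y i) : Model n) =
      (coordVec φ y i : Model n) := fun i => by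
    have h1 := mfderiv_comp y hfd hd
    have h2 := hev.mfderiv_eq (I := 𝓡 n) (I' := 𝓡 n)
    have h3 := DFunLike.congr_fun h1 (basisVec i)
    have h4 := DFunLike.congr_fun h2 (basisVec i)
    exact h3.symm.trans h4
  ext i j
  refine (g.inner_congr_point (h hy) _ _).trans ?_
  exact congrArg₂ (fun a b => (g.inner (φ.symm y) : Model n →L[ℝ] Model n →L[ℝ] ℝ) a b)
    (hc i) (hc j)

/-- Natural polydifferential operators commute with pullback by local diffeomorphisms. -/
theorem PolydiffOp.op_pullback [T2Space M] [SigmaCompactSpace M] [T2Space N] [SigmaCompactSpace N]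
    (D : PolydiffOp.{u} n) (g : Metric n M) {f : N → M}
    (hf : IsLocalDiffeomorph (𝓡 n) (𝓡 n) ∞ f) (v : Fin D.numArgs → SmoothFn n M) (x : N) :
    D.op (g.pullback f hf) (⨂ₜ[ℝ] j, pullbackFn f hf (v j)) x = D.op g (⨂ₜ[ℝ] j, v j) (f x) := by
  obtain ⟨a, ha⟩ := D.natural
  obtain ⟨Φ, hx, hΦ⟩ := hf x
  have hφ := IsManifold.chart_mem_maximalAtlas (I := 𝓡 n) (n := ∞) (f x)
  have hfx : f x = Φ x := hΦ hx
  set φ := chartAt (Model n) (f x)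
  have hxφ : f x ∈ φ.source := mem_chart_source _ _
  -- Near `x` the map `f` agrees with the partial diffeomorphism `Φ`; taking `φ ∘ Φ` as the chart at
  -- `x` makes `f` the identity in coordinates.
  set ψ := Φ.toOpenPartialHomeomorph.trans φ with hψ_def
  have hψ : ψ ∈ IsManifold.maximalAtlas (𝓡 n) ∞ N := trans_mem_maximalAtlas Φ hφ
  have hxψ : x ∈ ψ.source := ⟨hx, show Φ x ∈ φ.source from hfx ▸ hxφ⟩
  have hψx : ψ x = φ (f x) := congrArg φ hfx.symm
  have hsymm : Set.EqOn (f ∘ ψ.symm) φ.symm ψ.target := fun y hy => by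
    have h1 : φ.symm y ∈ Φ.target := hy.2
    exact (hΦ (Φ.map_target' h1)).trans (Φ.right_inv' h1)
  have hmem : ψ.target ∈ 𝓝 (ψ x) := ψ.open_target.mem_nhds (ψ.map_source hxψ)
  -- The same coefficients `a` serve both manifolds, so it remains to compare contractions term by
  -- term, at the common coordinate point `ψ x`.
  rw [ha _ _ ψ hψ x hxψ, ha g v φ hφ (f x) hxφ, ← hψx]
  refine Finsupp.sum_congr fun K _ => congrArg _ (K.eval_congr ?_ fun j => ?_)
  · filter_upwards [hmem] with y hy using g.coord_pullback hf hψ hsymm hy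
  · filter_upwards [hmem] with y hy using congrArg (v j) (hsymm hy)

end Pullback

/-! ### Scaling and conformal change of the cone -/

section Cone

variable {n : ℕ} {M : Type u} [TopologicalSpace M] [ChartedSpace (Model n) M]

theorem expFn_mul_expFn_neg_mul (w : ℝ) (Υ v : SmoothFn n M) :
    expFn w Υ * (expFn (-w) Υ * v) = v := by
  ext x
  change Real.exp (w * Υ x) * (Real.exp (-w * Υ x) * v x) = v x
  rw [← mul_assoc, ← Real.exp_add, ← add_mul, add_neg_cancel, zero_mul, Real.exp_zero, one_mul]

variable [IsManifold (𝓡 n) ∞ M] [T2Space M] [SigmaCompactSpace M] {r k : ℕ}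

theorem PolydiffOp.op_smul_tprod (D : PolydiffOp.{u} n) (g : Metric n M) (c : ℝ)
    (v : SmoothFn n M) :
    D.op g (⨂ₜ[ℝ] _ : Fin D.numArgs, c • v) =
      c ^ D.numArgs • D.op g (⨂ₜ[ℝ] _ : Fin D.numArgs, v) := by
  rw [MultilinearMap.map_smul_univ (PiTensorProduct.tprod ℝ) (fun _ => c) (fun _ => v), map_smul]
  simp

theorem ConstrainedOp.smul_mem_cone (P : ConstrainedOp.{u} n r k) {g : Metric n M}
    {v : SmoothFn n M} {c : ℝ} (hv : v ∈ P.cone g) (hc : 0 < c) : c • v ∈ P.cone g := by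
  intro C hC x
  rw [C.op_smul_tprod]
  exact mul_pos (pow_pos hc _) (hv C hC x)

theorem ConstrainedOp.mem_cone_conformal_iff (P : ConstrainedOp.{u} n r k) {g : Metric n M}
    {Υ v : SmoothFn n M} :
    v ∈ P.cone (g.conformal Υ) ↔
      expFn (((n : ℝ) - 2 * (k : ℝ)) / (r : ℝ)) Υ * v ∈ P.cone g := by
  refine forall₂_congr fun C hC => forall_congr' fun x => ?_
  obtain ⟨b, hb⟩ := P.transform_mem C hC
  rw [hb]
  exact mul_pos_iff_of_pos_left (Real.exp_pos _)

end Cone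

end ConfCone

theorem lemma1p3 {n r k : ℕ} (P : ConfCone.ConstrainedOp.{u} n r k) :
    -- invariance under positive scaling
    (∀ {M : Type u} [TopologicalSpace M] [ChartedSpace (ConfCone.Model n) M]
      [IsManifold (𝓡 n) ∞ M] [T2Space M] [SigmaCompactSpace M] (g : ConfCone.Metric n M)
      (v : ConfCone.SmoothFn n M) (c : ℝ), v ∈ P.cone g → 0 < c → c • v ∈ P.cone g) ∧
    -- conformal transformation
    (∀ {M : Type u} [TopologicalSpace M] [ChartedSpace (ConfCone.Model n) M]
      [IsManifold (𝓡 n) ∞ M] [T2Space M] [SigmaCompactSpace M] (g : ConfCone.Metric n M)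
      (Υ : ConfCone.SmoothFn n M),
      P.cone (g.conformal Υ) =
        (fun v => ConfCone.expFn (-(((n : ℝ) - 2 * (k : ℝ)) / (r : ℝ))) Υ * v) '' P.cone g) ∧
    -- pullback by local diffeomorphisms `f : N → M`
    (∀ {M : Type u} [TopologicalSpace M] [ChartedSpace (ConfCone.Model n) M]
      [IsManifold (𝓡 n) ∞ M] [T2Space M] [SigmaCompactSpace M]
      {N : Type u} [TopologicalSpace N] [ChartedSpace (ConfCone.Model n) N]
      [IsManifold (𝓡 n) ∞ N] [T2Space N] [SigmaCompactSpace N] (g : ConfCone.Metric n M)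
      (f : N → M) (hf : IsLocalDiffeomorph (𝓡 n) (𝓡 n) ∞ f),
      ConfCone.pullbackFn (n := n) f hf '' P.cone g ⊆ P.cone (g.pullback f hf)) := by
  refine ⟨fun g v c hv hc => P.smul_mem_cone hv hc, fun g Υ => ?_, fun g f hf => ?_⟩
  · ext v
    rw [P.mem_cone_conformal_iff]
    constructor
    · intro hv
      -- The preimage is `e^{wΥ} v` with `w = (n - 2k)/r`, read off from `hv`.
      refine ⟨_, hv, ?_⟩
      simpa only [neg_neg] using
        ConfCone.expFn_mul_expFn_neg_mul (-(((n : ℝ) - 2 * (k : ℝ)) / (r : ℝ))) Υ v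
    · rintro ⟨w, hw, rfl⟩
      rwa [ConfCone.expFn_mul_expFn_neg_mul]
  · rintro _ ⟨v, hv, rfl⟩ C hC x
    rw [C.op_pullback g hf (fun _ => v) x]
    exact hv C hC (f x)
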